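/- Notation. Let $\mathrm{Sym}(n,\mathbb R)$ be the space of real symmetric $n\times n$ matrices with a norm $\|\cdot\|$. For $A\in\mathrm{Sym}(n,\mathbb R)$ and $r\ge 0$ put $Q_A(z)={}^t zAz$ $(z\in\mathbb R^n)$ and $\Gamma_A^r=\{z\in\mathbb R^n: Q_A(z)\le r\}$, with topological boundary $\partial\Gamma_A^r$. We say that $\partial\Gamma_A^r$ is a variety of dimension $n-1$ if there is a $z\in\partial\Gamma_A^r$ with $Az\neq 0$, and that $\partial\Gamma_A^r$ and $\partial\Gamma_B^r$ intersect transversally at $z$ if $z\in\partial\Gamma_A^r\cap\partial\Gamma_B^r$ and $Az,Bz$ are linearly independent. The signature $(k,\ell_1)$ of $A$ consists of the numbers of positive and of negative eigenvalues of $A$, counted with multiplicity. For a linear subspace $W$ of $\mathrm{Sym}(n,\mathbb R)$, a matrix $A\in W$ has maximal rank in $W$ if $\operatorname{rank}M\le\operatorname{rank}A$ for all $M\in W$. Theorem. Let $W\neq\{0\}$ be a linear subspace of $\mathrm{Sym}(n,\mathbb R)$, and let $A\in W$ have maximal rank in $W$ and signature $(k,\ell_1)$. (a) Let $r\ge 0$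 and suppose that $k\ge 2$. Then there is an $\varepsilon>0$ (depending on $W$, $A$ and $r$) such that for every $B\in W$ with $\|B-A\|<\varepsilon$ the following holds: if $\partial\Gamma_A^r$ and $\partial\Gamma_B^r$ are varieties of dimension $n-1$, and if there is no point at which they intersect transversally, then $\Gamma_A^r\subset\Gamma_B^r$ or $\Gamma_B^r\subset\Gamma_A^r$. (b) Suppose that $\operatorname{rank}A\ge 3$. Then the conclusion of (a) holds for $r=0$, whatever $k$ is: there is an $\varepsilon>0$ (depending on $W$ and $A$) such that for every $B\in W$ with $\|B-A\|<\varepsilon$, if $\partial\Gamma_A^0$ and $\partial\Gamma_B^0$ are varieties of dimension $n-1$ that intersect transversally at no point, then $\Gamma_A^0\subset\Gamma_B^0$ or $\Gamma_B^0\subset\Gamma_A^0$. -/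

import Mathlib

-- The norm of a matrix is the operator norm for the Euclidean norm (all norms are equivalent here).
open scoped Matrix Matrix.Norms.L2Operator

/-- The space of real symmetric `n × n` matrices, as a subspace of all real `n × n` matrices. -/
def symMatrices (n : ℕ) : Submodule ℝ (Matrix (Fin n) (Fin n) ℝ) where
  carrier := {M | M.IsSymm}
  add_mem' hM hN := hM.add hN
  zero_mem' := Matrix.isSymm_zero
  smul_mem' c _ hM := hM.smul c

/-- `A` lies in the linear space `W` of matrices and has the largest rank among its elements. -/
def HasMaximalRankIn {n : ℕ} (W : Submodule ℝ (Matrix (Fin n) (Fin n) ℝ))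
    (A : Matrix (Fin n) (Fin n) ℝ) : Prop :=
  A ∈ W ∧ ∀ M ∈ W, M.rank ≤ A.rank

/-- The quadratic form `Q_A z = zᵗ A z` on `ℝⁿ`. -/
abbrev quadForm {n : ℕ} (A : Matrix (Fin n) (Fin n) ℝ) : QuadraticForm ℝ (Fin n → ℝ) :=
  A.toQuadraticForm'

theorem quadForm_apply {n : ℕ} (A : Matrix (Fin n) (Fin n) ℝ) (z : Fin n → ℝ) :
    quadForm A z = z ⬝ᵥ A *ᵥ z := by
  simp [quadForm, Matrix.toQuadraticForm', Matrix.toLinearMap₂'_apply']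

/-- The sublevel set `{z | Q_A z ≤ r}`. -/
def sublevel {n : ℕ} (A : Matrix (Fin n) (Fin n) ℝ) (r : ℝ) : Set (Fin n → ℝ) :=
  {z | quadForm A z ≤ r}

/-- The boundary of `{Q_A ≤ r}` is a variety of dimension `n - 1`: it contains a point `z` with
`A z ≠ 0` (near such a point it is an analytic hypersurface with normal vector `A z`). -/
def BoundaryHasDimPred {n : ℕ} (A : Matrix (Fin n) (Fin n) ℝ) (r : ℝ) : Prop :=
  ∃ z ∈ frontier (sublevel A r), A *ᵥ z ≠ 0

/-- The boundaries of `{Q_A ≤ r}` and `{Q_B ≤ r}` intersect transversally at `z`: the point lies on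
both of them, and the normal vectors `A z` and `B z` are linearly independent. -/
def IntersectTransversallyAt {n : ℕ} (A B : Matrix (Fin n) (Fin n) ℝ) (r : ℝ)
    (z : Fin n → ℝ) : Prop :=
  z ∈ frontier (sublevel A r) ∩ frontier (sublevel B r) ∧
    LinearIndependent ℝ ![A *ᵥ z, B *ᵥ z]

/-! Write a, b for the forms of A, B. If neither sublevel set contains the other, there are points x
with a ≤ r < b and y with b ≤ r < a; they are used to build a transversal intersection. Closeness of
B to A only serves to make both forms positive at a common vector and, if r = 0, negative at
another.

For r > 0, the form b - a takes both signs on the cone a > 0. This cone is connected, since k ≥ 2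
puts a positive vector in every hyperplane. So b - a vanishes somewhere on it, and a zero outside
the radical of b - a rescales to a transversal point (`exists_transversal_of_pos`).

For r = 0, x and y are moved to isotropic vectors w₁, w₂ of a at which b has opposite signs
(`exists_eq_lt`). A conic in the cone a = 0 joins them; on it b is a quartic with end coefficients
of opposite sign, hence with a simple root, and there the cones cross transversally
(`exists_transversal_zero`). Maximality of the rank makes b vanish on ker A, so w₁ and w₂ lie
outside ker A. Rank at least 3 gives two squares of one sign, and negating both forms exchanges the
signs. -/

open Filter Topology
/-! ### Quartics -/

theorem exists_pos_root_quartic {a₀ a₁ a₂ a₃ a₄ : ℝ} (h0 : 0 < a₀) (h4 : a₄ < 0) :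
    ∃ t > 0, a₀ + a₁ * t + a₂ * t ^ 2 + a₃ * t ^ 3 + a₄ * t ^ 4 = 0 := by
  -- With t = τ / (1 - τ), this is (1 - τ)⁴ times the quartic; its values at 0 and 1 are a₀ and a₄.
  let g : ℝ → ℝ := fun τ => a₀ * (1 - τ) ^ 4 + a₁ * (1 - τ) ^ 3 * τ + a₂ * (1 - τ) ^ 2 * τ ^ 2 +
    a₃ * (1 - τ) * τ ^ 3 + a₄ * τ ^ 4
  have hg : Continuous g := by fun_prop
  have hmem : (0 : ℝ) ∈ g '' Set.Icc 0 1 :=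
    intermediate_value_Icc' zero_le_one hg.continuousOn ⟨by simp [g, h4.le], by simp [g, h0.le]⟩
  obtain ⟨τ, ⟨hτ0, hτ1⟩, hτ⟩ := hmem
  have hτ0' : 0 < τ := by
    rcases hτ0.lt_or_eq with h | rfl
    · exact h
    · simp [g, h0.ne'] at hτ
  have hτ1' : 0 < 1 - τ := by
    rcases hτ1.lt_or_eq with h | rfl
    · linarith
    · simp [g, h4.ne] at hτ
  refine ⟨τ / (1 - τ), by positivity, ?_⟩
  have : a₀ + a₁ * (τ / (1 - τ)) + a₂ * (τ / (1 - τ)) ^ 2 + a₃ * (τ / (1 - τ)) ^ 3 +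
      a₄ * (τ / (1 - τ)) ^ 4 = g τ / (1 - τ) ^ 4 := by
    simp only [g]
    field_simp
  rw [this, hτ, zero_div]

theorem exists_neg_root_quartic {a₀ a₁ a₂ a₃ a₄ : ℝ} (h0 : 0 < a₀) (h4 : a₄ < 0) :
    ∃ t < 0, a₀ + a₁ * t + a₂ * t ^ 2 + a₃ * t ^ 3 + a₄ * t ^ 4 = 0 := by
  obtain ⟨t, ht, h⟩ := exists_pos_root_quartic (a₁ := -a₁) (a₂ := a₂) (a₃ := -a₃) h0 h4
  exact ⟨-t, by linarith, by linear_combination h⟩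

/-- A quartic that is positive at `0` and has negative leading coefficient has a simple root. -/
theorem exists_simple_root_quartic {a₀ a₁ a₂ a₃ a₄ : ℝ} (h0 : 0 < a₀) (h4 : a₄ < 0) :
    ∃ t, a₀ + a₁ * t + a₂ * t ^ 2 + a₃ * t ^ 3 + a₄ * t ^ 4 = 0 ∧
      a₁ + 2 * a₂ * t + 3 * a₃ * t ^ 2 + 4 * a₄ * t ^ 3 ≠ 0 := by
  by_contra! h
  obtain ⟨s, hs, hs0⟩ := exists_pos_root_quartic (a₁ := a₁) (a₂ := a₂) (a₃ := a₃) h0 h4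
  obtain ⟨t, ht, ht0⟩ := exists_neg_root_quartic (a₁ := a₁) (a₂ := a₂) (a₃ := a₃) h0 h4
  have hs1 := h s hs0
  have ht1 := h t ht0
  have hst : (s - t) ^ 3 ≠ 0 := pow_ne_zero _ (by linarith)
  -- Double roots at s and t force the quartic to be a₄(X - s)²(X - t)², with constant term a₄(st)²
  -- ≤ 0. The combination eliminates a₁, a₂ and a₃.
  have key : (s - t) ^ 3 * (a₀ - a₄ * (s * t) ^ 2) = 0 := by
    linear_combination (3 * s - t) * t ^ 2 * hs0 - s * t ^ 2 * (s - t) * hs1 +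
      (s - 3 * t) * s ^ 2 * ht0 - t * s ^ 2 * (s - t) * ht1
  have := (mul_eq_zero.mp key).resolve_left hst
  nlinarith [mul_nonneg_of_nonpos_of_nonpos h4.le (neg_nonpos.mpr (sq_nonneg (s * t)))]

/-! ### Pairs of symmetric bilinear forms -/

section Forms

variable {E : Type*} [AddCommGroup E] [Module ℝ E] {a b : LinearMap.BilinForm ℝ E}

/-- Along a line, a symmetric bilinear form is a quadratic polynomial. -/
theorem form_add_smul (ha : ∀ x y, a x y = a y x) (x v : E) (t : ℝ) :
    a (x + t • v) (x + t • v) = a x x + 2 * t * a x v + t ^ 2 * a v v := by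
  simp only [map_add, map_smul, LinearMap.add_apply, LinearMap.smul_apply, smul_eq_mul, ha v x]
  ring

theorem continuous_form_line (ha : ∀ x y, a x y = a y x) (x v : E) :
    Continuous fun t : ℝ => a (x + t • v) (x + t • v) := by
  simp only [form_add_smul ha]
  fun_prop

/-- If both forms are positive at `v`, then a point where `a ≤ r ≤ b` can be moved to a point
where `a = r < b`. -/
theorem exists_eq_lt (ha : ∀ x y, a x y = a y x) (hb : ∀ x y, b x y = b y x)
    {v : E} (hav : 0 < a v v) (hbv : 0 < b v v) {r : ℝ} {x : E}
    (hax : a x x ≤ r) (hbx : r ≤ b x x) (h : a x x < b x x) :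
    ∃ w, a w w = r ∧ r < b w w := by
  -- With this sign b increases along x + t • v for t ≥ 0, while a grows to infinity and must pass
  -- r.
  wlog hv : 0 ≤ b x v generalizing v
  · exact this (v := -v) (by simpa) (by simpa) (by simp; linarith)
  rcases hax.lt_or_eq with hax' | hax'
  swap
  · exact ⟨x, hax', by linarith⟩
  have hlim : Tendsto (fun t : ℝ => a x x + t * (2 * a x v + t * a v v)) atTop atTop :=
    tendsto_atTop_add_const_left _ _ <| tendsto_id.atTop_mul_atTop₀ <|
      tendsto_atTop_add_const_left _ _ <| tendsto_id.atTop_mul_const hav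
  obtain ⟨T, hT, hT0⟩ := ((hlim.eventually_ge_atTop r).and (eventually_ge_atTop 0)).exists
  obtain ⟨t, ⟨ht0, -⟩, ht⟩ : r ∈ (fun t : ℝ => a (x + t • v) (x + t • v)) '' Set.Icc 0 T := by
    refine intermediate_value_Icc hT0 (continuous_form_line ha x v).continuousOn ⟨by simpa, ?_⟩
    rw [form_add_smul ha]
    linarith
  refine ⟨x + t • v, ht, ?_⟩
  have ht0' : 0 < t := by
    rcases ht0.lt_or_eq with h | rfl
    · exact h
    · simp at ht; linarith
  rw [form_add_smul hb]
  have : 0 < t ^ 2 * b v v := by positivity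
  have : 0 ≤ 2 * t * b x v := by positivity
  linarith

theorem linearIndependent_or_eq_smul {V : Type*} [AddCommGroup V] [Module ℝ V] {x y : V}
    (hx : x ≠ 0) : LinearIndependent ℝ ![x, y] ∨ ∃ c : ℝ, y = c • x := by
  rw [LinearIndependent.pair_iff' hx, or_iff_not_imp_left]
  push Not
  exact fun ⟨c, hc⟩ => ⟨c, hc.symm⟩

/-- Two isotropic vectors of `a` that are not orthogonal, with `b` of opposite signs at them, lie
on a conic in the cone `a = 0`, on which `b` has a transversal zero. -/
theorem exists_transversal_zero_of_ne (ha : ∀ x y, a x y = a y x) (hb : ∀ x y, b x y = b y x)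
    (hplane : ∀ f : E →ₗ[ℝ] ℝ, ∃ v, f v = 0 ∧ 0 < a v v) {w₁ w₂ : E}
    (h₁ : a w₁ w₁ = 0) (h₂ : a w₂ w₂ = 0) (hb₁ : 0 < b w₁ w₁) (hb₂ : b w₂ w₂ < 0)
    (h₁₂ : a w₁ w₂ ≠ 0) :
    ∃ z, a z z = 0 ∧ b z z = 0 ∧ LinearIndependent ℝ ![a z, b z] := by
  obtain ⟨u, hu₁, hu₂, hu⟩ : ∃ u, a w₁ u = 0 ∧ a w₂ u = 0 ∧ 0 < a u u := by
    obtain ⟨v, hv, hpos⟩ := hplane (a w₁)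
    -- As w₁ is isotropic and orthogonal to v, adding a multiple of it preserves a v v and the
    -- orthogonality to w₁.
    refine ⟨v + (-(a w₂ v / a w₁ w₂)) • w₁, by simp [hv, h₁], ?_, ?_⟩
    · simp only [map_add, map_smul, smul_eq_mul, ha w₂ w₁]
      field_simp
      ring
    · simpa [form_add_smul ha, h₁, ha v, hv] using hpos
  -- On the conic below, a is t² times this expression.
  obtain ⟨c, hc0, hc⟩ : ∃ c : ℝ, c ≠ 0 ∧ a u u + 2 * c * a w₁ w₂ = 0 :=
    ⟨-(a u u) / (2 * a w₁ w₂), div_ne_zero (neg_ne_zero.mpr hu.ne') (by simpa), by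
      field_simp; ring⟩
  let w : ℝ → E := fun t => w₁ + t • u + (c * t ^ 2) • w₂
  have haw (t : ℝ) : a (w t) (w t) = 0 := by
    simp only [w, map_add, map_smul, LinearMap.add_apply, LinearMap.smul_apply, smul_eq_mul,
      ha u, hu₁, hu₂, h₁, h₂, ha w₂ w₁]
    linear_combination t ^ 2 * hc
  obtain ⟨t, ht, ht'⟩ := exists_simple_root_quartic (a₀ := b w₁ w₁) (a₁ := 2 * b w₁ u)
    (a₂ := b u u + 2 * c * b w₁ w₂) (a₃ := 2 * c * b u w₂) (a₄ := c ^ 2 * b w₂ w₂) hb₁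
    (mul_neg_of_pos_of_neg (by positivity) hb₂)
  refine ⟨w t, haw t, ?_, ?_⟩
  · simp only [w, map_add, map_smul, LinearMap.add_apply, LinearMap.smul_apply, smul_eq_mul,
      hb u w₁, hb w₂ w₁, hb w₂ u]
    linear_combination ht
  · have hne : a (w t) ≠ 0 := fun h => by
      have := congrArg (fun f => f w₂) h
      simp [w, h₂, ha u, hu₂, h₁₂] at this
    refine (linearIndependent_or_eq_smul hne).resolve_right fun ⟨μ, hμ⟩ => ht' ?_
    -- Evaluate at the velocity of the conic, which is a-orthogonal to w t: if b (w t) were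
    -- proportional to a (w t), the root would be multiple.
    have hd := congrArg (fun f => f (u + (2 * c * t) • w₂)) hμ
    simp only [w, map_add, map_smul, LinearMap.add_apply, LinearMap.smul_apply, smul_eq_mul,
      hb w₂ u, ha u, hu₁, hu₂, h₂] at hd
    linear_combination 2 * hd + 2 * μ * t * hc

theorem eventually_add_mul_ne {p q : ℝ} (hq : q ≠ 0) : ∀ᶠ s in 𝓝[≠] (0 : ℝ), p + s * q ≠ 0 := by
  rcases eq_or_ne p 0 with rfl | hp
  · filter_upwards [self_mem_nhdsWithin] with s hs
    simpa [hq] using hs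
  · have : Tendsto (fun s : ℝ => p + s * q) (𝓝[≠] 0) (𝓝 p) := by
      have : Continuous fun s : ℝ => p + s * q := by fun_prop
      simpa using (this.tendsto 0).mono_left nhdsWithin_le_nhds
    exact this.eventually_ne hp

theorem exists_apply_ne_zero_of_ne_zero {f g : E →ₗ[ℝ] ℝ} (hf : f ≠ 0) (hg : g ≠ 0) :
    ∃ d, f d ≠ 0 ∧ g d ≠ 0 := by
  obtain ⟨x, hx⟩ : ∃ x, f x ≠ 0 := by
    by_contra! h
    exact hf (LinearMap.ext h)
  obtain ⟨y, hy⟩ : ∃ y, g y ≠ 0 := by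
    by_contra! h
    exact hg (LinearMap.ext h)
  by_cases hgx : g x = 0
  · by_cases hfy : f y = 0
    · exact ⟨x + y, by simpa [hfy], by simpa [hgx]⟩
    · exact ⟨y, hfy, hy⟩
  · exact ⟨x, hx, hgx⟩

/-- If `b` takes both signs on the regular part of the cone `a = 0`, and `a` is positive definite
on some plane, then the cones `a = 0` and `b = 0` meet transversally somewhere. -/
theorem exists_transversal_zero (ha : ∀ x y, a x y = a y x) (hb : ∀ x y, b x y = b y x)
    (hplane : ∀ f : E →ₗ[ℝ] ℝ, ∃ v, f v = 0 ∧ 0 < a v v) {w₁ w₂ : E}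
    (h₁ : a w₁ w₁ = 0) (h₂ : a w₂ w₂ = 0) (hb₁ : 0 < b w₁ w₁) (hb₂ : b w₂ w₂ < 0)
    (hw₁ : a w₁ ≠ 0) (hw₂ : a w₂ ≠ 0) :
    ∃ z, a z z = 0 ∧ b z z = 0 ∧ LinearIndependent ℝ ![a z, b z] := by
  by_cases h₁₂ : a w₁ w₂ = 0
  swap
  · exact exists_transversal_zero_of_ne ha hb hplane h₁ h₂ hb₁ hb₂ h₁₂
  obtain ⟨e, he, hpos⟩ := hplane (a w₁)
  -- For small s ≠ 0 these two conditions make the reflection of w₁ non-orthogonal to w₂; it stays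
  -- isotropic, and near w₁, so b stays positive at it.
  obtain ⟨d, hd₁, hd₂⟩ := exists_apply_ne_zero_of_ne_zero hw₁ hw₂
  -- Reflect `w₁` in the hyperplane orthogonal to `e + s • d`, for a small `s`.
  let v : ℝ → E := fun s => e + s • d
  let k : ℝ → ℝ := fun s => -(2 * (s * a w₁ d) / a (v s) (v s))
  have hav : Continuous fun s => a (v s) (v s) := continuous_form_line ha e d
  have hpos' : ∀ᶠ s in 𝓝 (0 : ℝ), 0 < a (v s) (v s) :=
    hav.continuousAt.eventually_const_lt (by simpa [v] using hpos)
  have hv₁ (s : ℝ) : a w₁ (v s) = s * a w₁ d := by simp [v, he]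
  have hbpos : ∀ᶠ s in 𝓝 (0 : ℝ), 0 < b (w₁ + k s • v s) (w₁ + k s • v s) := by
    have hk : ContinuousAt k 0 := by
      refine ContinuousAt.neg (ContinuousAt.div (by fun_prop) hav.continuousAt ?_)
      simpa [v] using hpos.ne'
    have hbv : Continuous fun s => b (v s) (v s) := continuous_form_line hb e d
    have hbw : Continuous fun s => b w₁ (v s) := by
      simp only [v, map_add, map_smul, smul_eq_mul]
      fun_prop
    have hbw' := hbw.continuousAt (x := 0)
    have hbv' := hbv.continuousAt (x := 0)
    have : ContinuousAt (fun s => b (w₁ + k s • v s) (w₁ + k s • v s)) 0 := by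
      simp only [form_add_smul hb]
      exact ((continuousAt_const.add ((continuousAt_const.mul hk).mul hbw'))).add
        ((hk.pow 2).mul hbv')
    refine this.eventually_const_lt ?_
    simpa [k] using hb₁
  obtain ⟨s, ⟨⟨hs0, hs₁⟩, hs₂⟩, hs₃⟩ := (((eventually_mem_nhdsWithin (a := (0 : ℝ)) (s := {0}ᶜ)).and
    (hpos'.filter_mono nhdsWithin_le_nhds)).and (hbpos.filter_mono nhdsWithin_le_nhds)).and
    (eventually_add_mul_ne (p := a w₂ e) hd₂) |>.exists
  refine exists_transversal_zero_of_ne ha hb hplane (w₁ := w₁ + k s • v s) ?_ h₂ hs₂ hb₂ ?_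
  · rw [form_add_smul ha, h₁, hv₁]
    simp only [k]
    field_simp
    ring
  · have h2 : a (v s) w₂ = a w₂ e + s * a w₂ d := by simp [v, ha _ w₂]
    have hs0' : s ≠ 0 := hs0
    have hk : k s ≠ 0 := by
      simp only [k]
      exact neg_ne_zero.mpr (div_ne_zero (by positivity) hs₁.ne')
    simpa [h₁₂, h2, hk] using hs₃

/-- If `c` does not vanish on the segment from `x` to `y`, along which `a` is positive, then
`c` has the same sign at both ends. -/
theorem pos_of_segment {c : LinearMap.BilinForm ℝ E}
    (ha : ∀ x y, a x y = a y x) (hc : ∀ x y, c x y = c y x)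
    (hne : ∀ z, 0 < a z z → c z z ≠ 0) {x y : E} (hx : 0 < a x x) (hy : 0 < a y y)
    (hxy : 0 ≤ a x y) (hcx : 0 < c x x) : 0 < c y y := by
  by_contra! hcy
  obtain ⟨t, ⟨ht0, ht1⟩, ht⟩ :
      (0 : ℝ) ∈ (fun t : ℝ => c (x + t • (y - x)) (x + t • (y - x))) '' Set.Icc 0 1 :=
    intermediate_value_Icc' zero_le_one (continuous_form_line hc x (y - x)).continuousOn
      ⟨by simpa using hcy, by simpa using hcx.le⟩
  refine hne _ ?_ ht
  have hz : x + t • (y - x) = (1 - t) • x + t • y := by module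
  have hexp : a (x + t • (y - x)) (x + t • (y - x)) =
      (1 - t) ^ 2 * a x x + 2 * ((1 - t) * t) * a x y + t ^ 2 * a y y := by
    rw [hz, form_add_smul ha]
    simp only [map_smul, LinearMap.smul_apply, smul_eq_mul]
    ring
  rw [hexp]
  have h1 : 0 ≤ 1 - t := by linarith
  rcases ht0.lt_or_eq with h | rfl
  · have : 0 < t ^ 2 * a y y := by positivity
    positivity
  · simpa using hx

/-- The cone `a > 0` is connected, so a form that takes both signs on it has a zero in it. -/
theorem exists_zero_of_pos_of_neg {c : LinearMap.BilinForm ℝ E}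
    (ha : ∀ x y, a x y = a y x) (hc : ∀ x y, c x y = c y x)
    (hplane : ∀ f : E →ₗ[ℝ] ℝ, ∃ v, f v = 0 ∧ 0 < a v v) {x y : E}
    (hx : 0 < a x x) (hy : 0 < a y y) (hcx : 0 < c x x) (hcy : c y y < 0) :
    ∃ z, 0 < a z z ∧ c z z = 0 := by
  by_contra! hne
  -- The path goes from x to v, then to whichever of y and -y has nonnegative product with v.
  obtain ⟨v, hv, hvpos⟩ := hplane (a x)
  have hcv := pos_of_segment ha hc hne hx hvpos hv.ge hcx
  rcases le_total 0 (a v y) with h | h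
  · exact hcy.not_gt (pos_of_segment ha hc hne hvpos hy h hcv)
  · have := pos_of_segment ha hc hne hvpos (y := -y) (by simpa) (by simpa using h) hcv
    simp at this
    linarith

/-- An indefinite form has an isotropic vector outside its radical. -/
theorem exists_isotropic_not_mem_radical {c : LinearMap.BilinForm ℝ E}
    (hc : ∀ x y, c x y = c y x) {x y : E} (hcx : 0 < c x x) (hcy : c y y < 0) :
    ∃ h, c h h = 0 ∧ c h ≠ 0 := by
  obtain ⟨t, -, ht⟩ :
      (0 : ℝ) ∈ (fun t : ℝ => c (x + t • (y - x)) (x + t • (y - x))) '' Set.Icc 0 1 :=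
    intermediate_value_Icc' zero_le_one (continuous_form_line hc x (y - x)).continuousOn
      ⟨by simpa using hcy.le, by simpa using hcx.le⟩
  refine ⟨_, ht, fun h => ?_⟩
  have hx := congrArg (fun f => f x) h
  have hy := congrArg (fun f => f y) h
  simp only [map_add, map_sub, map_smul, LinearMap.add_apply, LinearMap.sub_apply,
    LinearMap.smul_apply, LinearMap.zero_apply, smul_eq_mul, hc y x] at hx hy
  -- The two sides have opposite signs, so a radical point on the segment is impossible.
  have : (1 - t) ^ 2 * c x x = t ^ 2 * c y y := by linear_combination (1 - t) * hx - t * hy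
  have h1 : 0 ≤ (1 - t) ^ 2 * c x x := by positivity
  have h2 : t ^ 2 * c y y ≤ 0 := mul_nonpos_of_nonneg_of_nonpos (by positivity) hcy.le
  have h3 : t = 0 := by
    have : t ^ 2 * c y y = 0 := by linarith
    simpa [hcy.ne] using this
  subst h3
  simp at this
  linarith

/-- A zero of `b - a` outside its radical and in the cone `a > 0` gives, after rescaling, a
transversal intersection of the level sets. -/
theorem exists_transversal_of_sub_ne_zero {r : ℝ} (hr : 0 < r) {z : E}
    (hz : 0 < a z z) (hcz : b z z = a z z) (hne : b z ≠ a z) :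
    ∃ z, a z z = r ∧ b z z = r ∧ LinearIndependent ℝ ![a z, b z] := by
  obtain ⟨s, hs, hs2⟩ : ∃ s : ℝ, s ≠ 0 ∧ s ^ 2 * a z z = r := by
    refine ⟨√(r / a z z), by positivity, ?_⟩
    rw [Real.sq_sqrt (by positivity)]
    field_simp
  have h (c : LinearMap.BilinForm ℝ E) : c (s • z) (s • z) = s ^ 2 * c z z := by
    simp only [map_smul, LinearMap.smul_apply, smul_eq_mul]
    ring
  refine ⟨s • z, by rw [h, hs2], by rw [h, hcz, hs2], ?_⟩
  have hne0 : a (s • z) ≠ 0 := fun h0 => by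
    have := congrArg (fun f => f z) h0
    simp [hs, hz.ne'] at this
  refine (linearIndependent_or_eq_smul hne0).resolve_right fun ⟨μ, hμ⟩ => hne ?_
  have h1 : b z = μ • a z := by
    rw [map_smul, map_smul, smul_comm] at hμ
    exact smul_right_injective _ hs hμ
  have h2 : μ = 1 := by
    have := congrArg (fun f => f z) h1
    simp only [LinearMap.smul_apply, smul_eq_mul, hcz] at this
    exact (mul_right_cancel₀ hz.ne' (by linarith)).symm
  rw [h1, h2, one_smul]

/-- If `a` is positive definite on some plane and `b - a` takes both signs on the cone `a > 0`,
then the level sets `a = r` and `b = r` meet transversally somewhere. -/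
theorem exists_transversal_of_pos (ha : ∀ x y, a x y = a y x) (hb : ∀ x y, b x y = b y x)
    (hplane : ∀ f : E →ₗ[ℝ] ℝ, ∃ v, f v = 0 ∧ 0 < a v v) {r : ℝ} (hr : 0 < r) {x y : E}
    (hx : 0 < a x x) (hy : 0 < a y y) (hbx : a x x < b x x) (hby : b y y < a y y) :
    ∃ z, a z z = r ∧ b z z = r ∧ LinearIndependent ℝ ![a z, b z] := by
  let c : LinearMap.BilinForm ℝ E := b - a
  have hcapp (u v : E) : c u v = b u v - a u v := rfl
  have hc (u v : E) : c u v = c v u := by rw [hcapp, hcapp, ha, hb]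
  have hcx : 0 < c x x := sub_pos.mpr hbx
  have hcy : c y y < 0 := sub_neg.mpr hby
  obtain ⟨z, hz, hcz⟩ := exists_zero_of_pos_of_neg ha hc hplane hx hy hcx hcy
  by_cases hrad : c z = 0
  swap
  · exact exists_transversal_of_sub_ne_zero hr hz (sub_eq_zero.mp hcz)
      fun h => hrad (sub_eq_zero.mpr h)
  -- If z is in the radical of c, then z + s • h is still a zero of c, and it leaves the radical as
  -- soon as s ≠ 0.
  obtain ⟨h, hh, hh'⟩ := exists_isotropic_not_mem_radical hc hcx hcy
  obtain ⟨s, hs0, hs⟩ := ((eventually_mem_nhdsWithin (a := (0 : ℝ)) (s := {0}ᶜ)).and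
    (((continuous_form_line ha z h).continuousAt.eventually_const_lt
      (by simpa using hz)).filter_mono nhdsWithin_le_nhds)).exists
  refine exists_transversal_of_sub_ne_zero hr hs (sub_eq_zero.mp ?_) fun h0 => ?_
  · change c _ _ = 0
    rw [form_add_smul hc, hcz, hrad, hh]
    simp
  · have : c (z + s • h) = 0 := sub_eq_zero.mpr h0
    rw [map_add, map_smul, hrad, zero_add] at this
    exact hh' ((smul_eq_zero.mp this).resolve_left hs0)

end Forms

/-! ### Symmetric matrices -/

section Matrices

variable {n : ℕ}

/-- The bilinear form `(x, y) ↦ xᵗ M y` of a matrix. -/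
noncomputable def matrixForm (M : Matrix (Fin n) (Fin n) ℝ) :
    LinearMap.BilinForm ℝ (Fin n → ℝ) :=
  Matrix.toLinearMap₂' ℝ M

theorem matrixForm_apply (M : Matrix (Fin n) (Fin n) ℝ) (x y : Fin n → ℝ) :
    matrixForm M x y = x ⬝ᵥ M *ᵥ y :=
  Matrix.toLinearMap₂'_apply' M x y

theorem matrixForm_neg (M : Matrix (Fin n) (Fin n) ℝ) : matrixForm (-M) = -matrixForm M := by
  simp [matrixForm]

theorem quadForm_eq_matrixForm (M : Matrix (Fin n) (Fin n) ℝ) (x : Fin n → ℝ) :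
    quadForm M x = matrixForm M x x := by
  rw [quadForm_apply, matrixForm_apply]

theorem matrixForm_comm {M : Matrix (Fin n) (Fin n) ℝ} (hM : M.IsSymm) (x y : Fin n → ℝ) :
    matrixForm M x y = matrixForm M y x := by
  rw [matrixForm_apply, matrixForm_apply, Matrix.dotProduct_mulVec, ← Matrix.mulVec_transpose,
    hM.eq, dotProduct_comm]

/-- The functional `M z` in the dual space is the image of the vector `M z`. -/
theorem matrixForm_eq_dotProduct {M : Matrix (Fin n) (Fin n) ℝ} (hM : M.IsSymm)
    (z : Fin n → ℝ) : matrixForm M z = dotProductBilin ℝ ℝ (M *ᵥ z) := by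
  refine LinearMap.ext fun y => ?_
  rw [matrixForm_comm hM, matrixForm_apply, dotProduct_comm]
  rfl

theorem matrixForm_eq_zero_iff {M : Matrix (Fin n) (Fin n) ℝ} (hM : M.IsSymm)
    {z : Fin n → ℝ} : matrixForm M z = 0 ↔ M *ᵥ z = 0 := by
  refine ⟨fun h => ?_, fun h => by rw [matrixForm_eq_dotProduct hM, h, map_zero]⟩
  rw [matrixForm_eq_dotProduct hM] at h
  have := congrArg (fun f => f (M *ᵥ z)) h
  exact dotProduct_self_eq_zero.mp this

theorem linearIndependent_mulVec {A B : Matrix (Fin n) (Fin n) ℝ} (hA : A.IsSymm)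
    (hB : B.IsSymm) {z : Fin n → ℝ}
    (h : LinearIndependent ℝ ![matrixForm A z, matrixForm B z]) :
    LinearIndependent ℝ ![A *ᵥ z, B *ᵥ z] := by
  refine LinearIndependent.of_comp (dotProductBilin ℝ ℝ) ?_
  convert h using 1
  ext1 i
  fin_cases i
  · simp [matrixForm_eq_dotProduct hA]
  · simp [matrixForm_eq_dotProduct hB]

theorem continuous_quadForm (M : Matrix (Fin n) (Fin n) ℝ) : Continuous (quadForm M) := by
  have : (quadForm M : (Fin n → ℝ) → ℝ) = fun z => z ⬝ᵥ M *ᵥ z := funext (quadForm_apply M)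
  rw [this]
  fun_prop

/-- A point with `Q_M = r` is on the boundary of `{Q_M ≤ r}`, as soon as `Q_M` is somewhere
positive. -/
theorem mem_frontier_sublevel {M : Matrix (Fin n) (Fin n) ℝ} (hM : M.IsSymm) {v : Fin n → ℝ}
    (hv : 0 < matrixForm M v v) {r : ℝ} {z : Fin n → ℝ} (hz : matrixForm M z z = r) :
    z ∈ frontier (sublevel M r) := by
  wlog hzv : 0 ≤ matrixForm M z v generalizing v
  · exact this (v := -v) (by simpa) (by simp; linarith)
  refine ⟨subset_closure (by simp [sublevel, quadForm_eq_matrixForm, hz]), fun hint => ?_⟩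
  have hlim : Tendsto (fun t : ℝ => z + t • v) (𝓝[>] 0) (𝓝 z) := by
    have : Continuous fun t : ℝ => z + t • v := by fun_prop
    simpa using (this.tendsto 0).mono_left nhdsWithin_le_nhds
  obtain ⟨t, ht, ht0⟩ := ((hlim.eventually (mem_interior_iff_mem_nhds.mp hint)).and
    self_mem_nhdsWithin).exists
  have ht0' : 0 < t := ht0
  have ht' : matrixForm M (z + t • v) (z + t • v) ≤ r := by
    rw [← quadForm_eq_matrixForm]
    exact ht
  rw [form_add_smul (matrixForm_comm hM), hz] at ht'
  have h1 : 0 < t ^ 2 * matrixForm M v v := by positivity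
  have h2 : 0 ≤ 2 * t * matrixForm M z v := by positivity
  linarith

theorem matrixForm_eq_of_mem_frontier {M : Matrix (Fin n) (Fin n) ℝ} {r : ℝ} {z : Fin n → ℝ}
    (hz : z ∈ frontier (sublevel M r)) : matrixForm M z z = r := by
  rw [← quadForm_eq_matrixForm]
  exact frontier_le_subset_eq (continuous_quadForm M) continuous_const hz

theorem intersectTransversallyAt_of_form {A B : Matrix (Fin n) (Fin n) ℝ} (hA : A.IsSymm)
    (hB : B.IsSymm) {u v : Fin n → ℝ} (hu : 0 < matrixForm A u u) (hv : 0 < matrixForm B v v)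
    {r : ℝ} {z : Fin n → ℝ} (hAz : matrixForm A z z = r) (hBz : matrixForm B z z = r)
    (h : LinearIndependent ℝ ![matrixForm A z, matrixForm B z]) :
    IntersectTransversallyAt A B r z :=
  ⟨⟨mem_frontier_sublevel hA hu hAz, mem_frontier_sublevel hB hv hBz⟩,
    linearIndependent_mulVec hA hB h⟩

/-- The product of z with M z is |M z|² > 0, so adding a large multiple of the isotropic z to M z
makes the form positive. -/
theorem exists_pos_of_isotropic {M : Matrix (Fin n) (Fin n) ℝ} (hM : M.IsSymm)
    {z : Fin n → ℝ} (hz : matrixForm M z z = 0) (hne : M *ᵥ z ≠ 0) :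
    ∃ v, 0 < matrixForm M v v := by
  have hc := matrixForm_comm hM
  obtain ⟨w, hw⟩ : ∃ w, 0 < matrixForm M z w := by
    refine ⟨M *ᵥ z, ?_⟩
    rw [matrixForm_eq_dotProduct hM]
    change 0 < (M *ᵥ z) ⬝ᵥ (M *ᵥ z)
    exact lt_of_le_of_ne (Finset.sum_nonneg fun i _ => mul_self_nonneg _)
      (Ne.symm (mt dotProduct_self_eq_zero.mp hne))
  have hlim : Tendsto (fun t : ℝ => matrixForm M w w + 2 * t * matrixForm M z w)
      atTop atTop :=
    tendsto_atTop_add_const_left _ _ <|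
      (tendsto_id.const_mul_atTop two_pos).atTop_mul_const hw
  obtain ⟨t, ht⟩ := (hlim.eventually_gt_atTop 0).exists
  refine ⟨w + t • z, ?_⟩
  rw [form_add_smul hc, hz, hc w z]
  linarith

theorem exists_neg_of_isotropic {M : Matrix (Fin n) (Fin n) ℝ} (hM : M.IsSymm)
    {z : Fin n → ℝ} (hz : matrixForm M z z = 0) (hne : M *ᵥ z ≠ 0) :
    ∃ v, matrixForm M v v < 0 := by
  obtain ⟨v, hv⟩ := exists_pos_of_isotropic (M := -M) (z := z) hM.neg (by simp [matrixForm_neg, hz])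
    (by simpa [Matrix.neg_mulVec] using hne)
  exact ⟨v, by simpa [matrixForm_neg] using hv⟩

theorem continuous_matrixForm_self (v : Fin n → ℝ) :
    Continuous fun M : Matrix (Fin n) (Fin n) ℝ => matrixForm M v v := by
  simp only [matrixForm_apply]
  fun_prop

/-- A form with at least two positive squares has a positive vector in each hyperplane. -/
theorem exists_pos_mem_ker_of_two_le_sigPos {Q : QuadraticForm ℝ (Fin n → ℝ)}
    (h : 2 ≤ sigPos Q) (f : (Fin n → ℝ) →ₗ[ℝ] ℝ) : ∃ v, f v = 0 ∧ 0 < Q v := by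
  obtain ⟨V, hV, hpos⟩ := exists_finrank_eq_sigPos_and_posDef Q
  have : 0 < Module.finrank ℝ (LinearMap.ker (f.domRestrict V)) := by
    have h1 := (f.domRestrict V).finrank_range_add_finrank_ker
    have h2 := (LinearMap.range (f.domRestrict V)).finrank_le
    rw [Module.finrank_self] at h2
    omega
  obtain ⟨v, hv, hne⟩ := Submodule.exists_mem_ne_zero_of_ne_bot
    (p := LinearMap.ker (f.domRestrict V)) (fun h => this.ne' (by rw [h]; exact finrank_bot ℝ V))
  exact ⟨v, by simpa using hv, hpos v hne⟩

theorem sigPos_add_sigNeg_quadForm {M : Matrix (Fin n) (Fin n) ℝ} (hM : M.IsSymm) :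
    sigPos (quadForm M) + sigNeg (quadForm M) = M.rank := by
  have h1 := QuadraticForm.sigPos_add_sigNeg_add_radical (Q := quadForm M)
  have h2 := M.mulVecLin.finrank_range_add_finrank_ker
  have h3 : (quadForm M).radical = LinearMap.ker M.mulVecLin := by
    ext m
    have hexp (x : Fin n → ℝ) := form_add_smul (matrixForm_comm hM) m x 1
    simp only [one_smul] at hexp
    simp only [QuadraticMap.mem_radical_iff', quadForm_eq_matrixForm, hexp, LinearMap.mem_ker,
      Matrix.mulVecLin_apply, ← matrixForm_eq_zero_iff hM]
    refine ⟨fun h => LinearMap.ext fun x => ?_, fun h => by simp [h]⟩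
    have := h.2 x
    rw [LinearMap.zero_apply]
    linarith [h.1]
  rw [h3] at h1
  rw [Matrix.rank]
  omega

/-- The matrices of a linear space vanish on the kernel of a member of maximal rank. -/
theorem matrixForm_self_eq_zero_of_mulVec_eq_zero {W : Submodule ℝ (Matrix (Fin n) (Fin n) ℝ)}
    {A B : Matrix (Fin n) (Fin n) ℝ} (hA : HasMaximalRankIn W A) (hAs : A.IsSymm) (hB : B ∈ W)
    {p : Fin n → ℝ} (hp : A *ᵥ p = 0) : matrixForm B p p = 0 := by
  by_contra hne
  obtain ⟨e, he⟩ : ∃ e : Fin A.rank → Fin n → ℝ, LinearIndependent ℝ fun i => A *ᵥ e i := by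
    let bs := Module.finBasisOfFinrankEq ℝ (LinearMap.range A.mulVecLin) (n := A.rank) rfl
    choose e he using fun i => (bs i).2
    refine ⟨e, ?_⟩
    have := bs.linearIndependent.map' (LinearMap.range A.mulVecLin).subtype (by simp)
    have heq : (fun i => A *ᵥ e i) = (LinearMap.range A.mulVecLin).subtype ∘ bs := funext he
    rw [heq]
    exact this
  -- At t = 0 the vectors are independent: p is orthogonal to the range of A but not to B p.
  -- Independence is open, and for t ≠ 0 all of them lie in the range of A + t • B, whose rank would
  -- exceed that of A.
  let F : ℝ → Fin (A.rank + 1) → Fin n → ℝ :=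
    fun t => Fin.cons (B *ᵥ p) fun i => (A + t • B) *ᵥ e i
  have hF0 : LinearIndependent ℝ (F 0) := by
    refine linearIndependent_finCons.mpr ⟨by simpa using he, fun hmem => hne ?_⟩
    have hle : Submodule.span ℝ (Set.range fun i => (A + (0 : ℝ) • B) *ᵥ e i) ≤
        LinearMap.ker (dotProductBilin ℝ ℝ p) := by
      rw [Submodule.span_le]
      rintro _ ⟨i, rfl⟩
      have h := matrixForm_comm hAs p (e i)
      rw [matrixForm_apply, matrixForm_apply, hp, dotProduct_zero] at h
      simpa using h
    rw [matrixForm_apply]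
    exact hle hmem
  have hcont : Continuous F := by
    refine continuous_pi fun i => ?_
    refine Fin.cases ?_ (fun j => ?_) i
    · exact continuous_const
    · simp only [F, Fin.cons_succ]
      fun_prop
  have hev : ∀ᶠ t in 𝓝 (0 : ℝ), LinearIndependent ℝ (F t) :=
    hcont.continuousAt.eventually (isOpen_setOfPred_linearIndependent.mem_nhds hF0)
  obtain ⟨t, ht0, ht⟩ := ((eventually_mem_nhdsWithin (a := (0 : ℝ)) (s := {0}ᶜ)).and
    (hev.filter_mono nhdsWithin_le_nhds)).exists
  have hrank := hA.2 _ (W.add_mem hA.1 (W.smul_mem t hB))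
  have hsub : Submodule.span ℝ (Set.range (F t)) ≤ LinearMap.range (A + t • B).mulVecLin := by
    rw [Submodule.span_le]
    rintro _ ⟨i, rfl⟩
    refine Fin.cases ?_ (fun j => ?_) i
    · refine ⟨t⁻¹ • p, ?_⟩
      have : t ≠ 0 := ht0
      simp [F, Matrix.add_mulVec, Matrix.smul_mulVec, hp, smul_smul, this]
    · exact ⟨e j, rfl⟩
  have := Submodule.finrank_mono hsub
  rw [finrank_span_eq_card ht, Fintype.card_fin] at this
  exact absurd (this.trans hrank) (by simp)

/-! ### Comparison of sublevel sets -/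

/-- Away from `r = 0`: nested sublevel sets from the absence of transversal intersections. -/
theorem sublevel_subset_or_subset_of_pos {A B : Matrix (Fin n) (Fin n) ℝ} (hA : A.IsSymm)
    (hB : B.IsSymm) {r : ℝ} (hr : 0 < r) (hsig : 2 ≤ sigPos (quadForm A)) {v : Fin n → ℝ}
    (hAv : 0 < matrixForm A v v) (hBv : 0 < matrixForm B v v)
    (hnt : ¬ ∃ z, IntersectTransversallyAt A B r z) :
    sublevel A r ⊆ sublevel B r ∨ sublevel B r ⊆ sublevel A r := by
  by_contra! h
  obtain ⟨⟨x, hxA, hxB⟩, ⟨y, hyB, hyA⟩⟩ :=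
    And.intro (Set.not_subset.mp h.1) (Set.not_subset.mp h.2)
  simp only [sublevel, Set.mem_ofPred_eq, quadForm_eq_matrixForm, not_le] at hxA hxB hyA hyB
  obtain ⟨w, hw, hw'⟩ := exists_eq_lt (matrixForm_comm hA) (matrixForm_comm hB) hAv hBv hxA
    hxB.le (hxA.trans_lt hxB)
  obtain ⟨z, hAz, hBz, hz⟩ := exists_transversal_of_pos (matrixForm_comm hA) (matrixForm_comm hB)
    (fun f => by
      simpa only [quadForm_eq_matrixForm] using exists_pos_mem_ker_of_two_le_sigPos hsig f)
    hr (x := w) (y := y) (hr.trans_eq hw.symm) (hr.trans hyA) (hw.trans_lt hw')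
    (hyB.trans_lt hyA)
  exact hnt ⟨z, intersectTransversallyAt_of_form hA hB hAv hBv hAz hBz hz⟩

/-- The case `r = 0`: nested sublevel sets from the absence of transversal intersections. -/
theorem sublevel_zero_subset_or_subset {A B : Matrix (Fin n) (Fin n) ℝ} (hA : A.IsSymm)
    (hB : B.IsSymm) (hrank : 3 ≤ A.rank ∨ 2 ≤ sigPos (quadForm A))
    (hker : ∀ p, A *ᵥ p = 0 → matrixForm B p p = 0) {u v : Fin n → ℝ}
    (hAv : 0 < matrixForm A v v) (hBv : 0 < matrixForm B v v)
    (hAu : matrixForm A u u < 0) (hBu : matrixForm B u u < 0)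
    (hnt : ¬ ∃ z, IntersectTransversallyAt A B 0 z) :
    sublevel A 0 ⊆ sublevel B 0 ∨ sublevel B 0 ⊆ sublevel A 0 := by
  by_contra! h
  obtain ⟨⟨x, hxA, hxB⟩, ⟨y, hyB, hyA⟩⟩ :=
    And.intro (Set.not_subset.mp h.1) (Set.not_subset.mp h.2)
  simp only [sublevel, Set.mem_ofPred_eq, quadForm_eq_matrixForm, not_le] at hxA hxB hyA hyB
  have hAc := matrixForm_comm hA
  have hBc := matrixForm_comm hB
  have hAc' := matrixForm_comm hA.neg
  have hBc' := matrixForm_comm hB.neg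
  have hneg (M : Matrix (Fin n) (Fin n) ℝ) (x y : Fin n → ℝ) :
      matrixForm (-M) x y = -matrixForm M x y := by rw [matrixForm_neg]; rfl
  obtain ⟨w₁, hA₁, hB₁⟩ := exists_eq_lt hAc hBc hAv hBv hxA hxB.le (hxA.trans_lt hxB)
  -- Applied to -A and -B, with u as the common positive vector.
  obtain ⟨w₂, hA₂, hB₂⟩ := exists_eq_lt (r := 0) (x := y) (v := u) hAc' hBc'
    (by rw [hneg]; linarith) (by rw [hneg]; linarith) (by rw [hneg]; linarith)
    (by rw [hneg]; linarith) (by rw [hneg, hneg]; linarith)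
  rw [hneg] at hA₂ hB₂
  have hne₁ : A *ᵥ w₁ ≠ 0 := fun h => hB₁.ne' (hker _ h)
  have hne₂ : A *ᵥ w₂ ≠ 0 := fun h => by linarith [hker _ h]
  have hsig : 2 ≤ sigPos (quadForm A) ∨ 2 ≤ sigNeg (quadForm A) := by
    have := sigPos_add_sigNeg_quadForm hA
    omega
  rcases hsig with hsig | hsig
  · obtain ⟨z, hAz, hBz, hz⟩ := exists_transversal_zero hAc hBc
      (fun f => by
        simpa only [quadForm_eq_matrixForm] using exists_pos_mem_ker_of_two_le_sigPos hsig f)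
      hA₁ (by linarith) hB₁ (by linarith) (mt (matrixForm_eq_zero_iff hA).mp hne₁)
      (mt (matrixForm_eq_zero_iff hA).mp hne₂)
    exact hnt ⟨z, intersectTransversallyAt_of_form hA hB hAv hBv hAz hBz hz⟩
  · obtain ⟨z, hAz, hBz, hz⟩ := exists_transversal_zero (w₁ := w₂) (w₂ := w₁) hAc' hBc'
      (fun f => by
        simpa only [hneg, neg_apply, quadForm_eq_matrixForm] using
          exists_pos_mem_ker_of_two_le_sigPos (Q := -quadForm A) (by simpa using hsig) f)
      (by rw [hneg, hA₂]) (by rw [hneg, hA₁, neg_zero]) (by rwa [hneg])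
      (by rw [hneg]; linarith)
      (by rw [matrixForm_neg]; exact neg_ne_zero.mpr (mt (matrixForm_eq_zero_iff hA).mp hne₂))
      (by rw [matrixForm_neg]; exact neg_ne_zero.mpr (mt (matrixForm_eq_zero_iff hA).mp hne₁))
    rw [hneg, neg_eq_zero] at hAz hBz
    refine hnt ⟨z, intersectTransversallyAt_of_form hA hB hAv hBv hAz hBz ?_⟩
    rw [LinearIndependent.pair_iff] at hz ⊢
    intro s t hst
    refine hz s t ?_
    simp only [matrixForm_neg, LinearMap.neg_apply, smul_neg]
    rw [← neg_add, hst, neg_zero]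

/-- Nested zero sublevel sets for all `B` in `W` near a member `A` of maximal rank. -/
theorem exists_forall_sublevel_zero_subset_or_subset
    {W : Submodule ℝ (Matrix (Fin n) (Fin n) ℝ)} (hWsym : W ≤ symMatrices n)
    {A : Matrix (Fin n) (Fin n) ℝ} (hA : HasMaximalRankIn W A)
    (hrank : 3 ≤ A.rank ∨ 2 ≤ sigPos (quadForm A)) :
    ∃ ε > 0, ∀ B ∈ W, ‖B - A‖ < ε →
      BoundaryHasDimPred A 0 → BoundaryHasDimPred B 0 →
      (¬ ∃ z, IntersectTransversallyAt A B 0 z) →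
      sublevel A 0 ⊆ sublevel B 0 ∨ sublevel B 0 ⊆ sublevel A 0 := by
  have hAs : A.IsSymm := hWsym hA.1
  by_cases hdim : BoundaryHasDimPred A 0
  swap
  · exact ⟨1, one_pos, fun _ _ _ h => absurd h hdim⟩
  obtain ⟨p, hp, hAp⟩ := hdim
  have hp0 := matrixForm_eq_of_mem_frontier hp
  obtain ⟨v, hv⟩ := exists_pos_of_isotropic hAs hp0 hAp
  obtain ⟨u, hu⟩ := exists_neg_of_isotropic hAs hp0 hAp
  obtain ⟨ε, hε, h⟩ := Metric.eventually_nhds_iff.mp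
    (((continuous_matrixForm_self v).continuousAt.eventually_const_lt hv).and
      ((continuous_matrixForm_self u).continuousAt.eventually_lt_const hu))
  refine ⟨ε, hε, fun B hB hBA _ _ hnt => ?_⟩
  obtain ⟨hBv, hBu⟩ := h (by rwa [dist_eq_norm])
  exact sublevel_zero_subset_or_subset hAs (hWsym hB) hrank
    (fun q => matrixForm_self_eq_zero_of_mulVec_eq_zero hA hAs hB) hv hBv hu hBu hnt

end Matrices

theorem theorem2p6 {n : ℕ} (W : Submodule ℝ (Matrix (Fin n) (Fin n) ℝ))
    (hWsym : W ≤ symMatrices n) (hW : W ≠ ⊥)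
    (A : Matrix (Fin n) (Fin n) ℝ) (hA : HasMaximalRankIn W A) :
    (∀ r : ℝ, 0 ≤ r → 2 ≤ sigPos (quadForm A) →
      ∃ ε > 0, ∀ B ∈ W, ‖B - A‖ < ε →
        BoundaryHasDimPred A r → BoundaryHasDimPred B r →
        (¬ ∃ z, IntersectTransversallyAt A B r z) →
        sublevel A r ⊆ sublevel B r ∨ sublevel B r ⊆ sublevel A r) ∧
    (3 ≤ A.rank →
      ∃ ε > 0, ∀ B ∈ W, ‖B - A‖ < ε →
        BoundaryHasDimPred A 0 → BoundaryHasDimPred B 0 →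
        (¬ ∃ z, IntersectTransversallyAt A B 0 z) →
        sublevel A 0 ⊆ sublevel B 0 ∨ sublevel B 0 ⊆ sublevel A 0) := by
  refine ⟨fun r hr hsig => ?_, fun hrank =>
    exists_forall_sublevel_zero_subset_or_subset hWsym hA (.inl hrank)⟩
  rcases hr.eq_or_lt with rfl | hr
  · exact exists_forall_sublevel_zero_subset_or_subset hWsym hA (.inr hsig)
  -- The zero functional imposes no condition: only a positive vector is wanted.
  obtain ⟨v, -, hv⟩ := exists_pos_mem_ker_of_two_le_sigPos hsig 0
  rw [quadForm_eq_matrixForm] at hv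
  obtain ⟨ε, hε, h⟩ := Metric.eventually_nhds_iff.mp
    ((continuous_matrixForm_self v).continuousAt.eventually_const_lt hv)
  exact ⟨ε, hε, fun B hB hBA _ _ hnt => sublevel_subset_or_subset_of_pos (hWsym hA.1)
    (hWsym hB) hr hsig hv (h (by rwa [dist_eq_norm])) hnt⟩
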